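/- Let $n\ge 1$ be an integer. Within a family of cubes in $\mathbb{R}^d$, two cubes \emph{see each other} in direction $\mathbf{e}_i$ if there is a cylindrical channel of positive radius, parallel to $\mathbf{e}_i$, with one end in one of them and the other end in the other, that meets no other cube of the family (in $\mathbb{R}^1$ a channel is a segment). A graph $G$ is an \emph{$n$-cube visibility graph} if its vertices can be assigned to pairwise disjoint axis-aligned closed unit $n$-cubes in $\mathbb{R}^n$ such that two distinct vertices are adjacent if and only if their cubes see each other in the direction of some standard basis vector. For $m\ge 0$, $G$ is an \emph{$m$-cube orthogonal visibility graph} if its vertices can be assigned to pairwise disjoint closed unit $m$-cubes in $\mathbb{R}^{m+1}$, each aligned with the first $m$ axes (so lying in a hyperplane orthogonal to $\mathbf{e}_{m+1}$), such that two distinct vertices are adjacent if and only if their cubes see each other in the direction $\mathbf{e}_{m+1}$. An \emph{$m$-cube orthogonal visibility forest} is a disjoint union of trees each of which is an $m$-cube orthogonal visibility graph. \textbf{Theorem.} A finite tree $T$ is an $n$-cube visibility graph if and only if $T$ is the union of $n$ subgraphs $F_1,\dots,F_n$, each of which is an $(n-1)$-cube orthogonal visibility forest. -/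

import Mathlib

namespace CubeVisibility

/-- The closed axis-aligned unit `d`-cube in `ℝ^d` with centre `c`. -/
def cube {d : ℕ} (c : Fin d → ℝ) : Set (Fin d → ℝ) :=
  {x | ∀ j, |x j - c j| ≤ 1 / 2}

/-- The closed unit `m`-cube in `ℝ^(m+1)` with centre `c` that is aligned with the first `m` axes;
it lies in the hyperplane on which the last coordinate equals that of `c`. -/
def orthCube {m : ℕ} (c : Fin (m + 1) → ℝ) : Set (Fin (m + 1) → ℝ) :=
  {x | (∀ j, j ≠ Fin.last m → |x j - c j| ≤ 1 / 2) ∧ x (Fin.last m) = c (Fin.last m)}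

/-- The round disk of radius `r` at height `h` in direction `i`, orthogonal to the `i`-th axis and
centred on the line through `z` parallel to that axis. For `d = 1` it is a single point. -/
def disk {d : ℕ} (i : Fin d) (z : Fin d → ℝ) (r h : ℝ) : Set (Fin d → ℝ) :=
  {x | x i = h ∧ ∑ j ∈ Finset.univ.erase i, (x j - z j) ^ 2 < r ^ 2}

/-- The round cylinder of radius `r` with axis parallel to the `i`-th axis through `z`, between
the heights `s` and `t` (in either order). -/
def channel {d : ℕ} (i : Fin d) (z : Fin d → ℝ) (r s t : ℝ) : Set (Fin d → ℝ) :=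
  ⋃ h ∈ Set.uIcc s t, disk i z r h

/-- The objects `B u` and `B v` see each other in direction `i` within the family `B`: a
cylindrical channel of positive radius parallel to the `i`-th axis has one end in `B u`, the other
end in `B v`, and meets no other object of the family. -/
def Sees {V : Type*} {d : ℕ} (B : V → Set (Fin d → ℝ)) (i : Fin d) (u v : V) : Prop :=
  ∃ (z : Fin d → ℝ) (r s t : ℝ), 0 < r ∧ disk i z r s ⊆ B u ∧ disk i z r t ⊆ B v ∧
    ∀ w, w ≠ u → w ≠ v → Disjoint (channel i z r s t) (B w)

/-- `G` has an `n`-cube visibility representation: pairwise disjoint unit `n`-cubes in `ℝ^n`, one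
for each vertex, with adjacency being visibility in the direction of some axis. -/
def IsVisibilityGraph {V : Type*} (n : ℕ) (G : SimpleGraph V) : Prop :=
  ∃ c : V → Fin n → ℝ,
    (∀ u v, u ≠ v → Disjoint (cube (c u)) (cube (c v))) ∧
    ∀ u v, u ≠ v → (G.Adj u v ↔ ∃ i : Fin n, Sees (fun w => cube (c w)) i u v)

/-- `G` has an `m`-cube orthogonal visibility representation: pairwise disjoint unit `m`-cubes in
`ℝ^(m+1)` aligned with the first `m` axes, one for each vertex, with adjacency being visibility in
the direction of the last axis. -/
def IsOrthVisibilityGraph {V : Type*} (m : ℕ) (G : SimpleGraph V) : Prop :=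
  ∃ c : V → Fin (m + 1) → ℝ,
    (∀ u v, u ≠ v → Disjoint (orthCube (c u)) (orthCube (c v))) ∧
    ∀ u v, u ≠ v → (G.Adj u v ↔ Sees (fun w => orthCube (c w)) (Fin.last m) u v)

/-- `G` is an `m`-cube orthogonal visibility forest: a disjoint union of trees each of which is an
`m`-cube orthogonal visibility graph. -/
def IsOrthVisibilityForest {V : Type*} (m : ℕ) (G : SimpleGraph V) : Prop :=
  ∀ C : G.ConnectedComponent, C.toSimpleGraph.IsTree ∧ IsOrthVisibilityGraph m C.toSimpleGraph

end CubeVisibility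

/-! Disjoint unit cubes met by one line parallel to an axis have centres more than 1 apart along it,
so each cube may be flattened to its middle slice without changing what is visible in that
direction. This reduces channels to lines and centres (`sees_cube_iff`, `sees_orthCube_iff`).

The visibility graph in one direction is then a forest represented by slices, provided each
component still represents itself once the others are removed. It does: the slices that a generic
line meets between two given ones lie on a path of the visibility graph, so removing a slice opens
no new view between vertices whose connecting paths avoid it (`LineVisible.of_subfamily`). In a
forest, where paths are unique, the same argument shows that a represented forest represents all its
subforests (`Represents.anti`).

For the converse, each edge of `T` therefore gets a single colour; let `H i` consist of the edges of
colour `i` and `R j` of the edges of colours other than `j`. By `exists_coordinate` the `j`-th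
coordinate can be chosen so that its differences along edges of colour `i ≠ j` are copied from the
representation of `H i`, distinct components of `R j` are more than 1 apart, and the heights within
each component of `H j` keep their strict order. Cubes whose shadows along axis `i` meet are joined
in `R j` for all `j ≠ i`, so the tree path between them has only edges of colour `i`. Hence only
cubes of one component of `H i` interact in direction `i`, and there the picture is the prescribed
one, translated across the axis and with its order along the axis kept. -/

namespace CubeVisibility

open Filter Topology

/-! ### Visibility along lines -/

/-- Some line parallel to the `i`-th axis meets the interiors of the shadows of the unit cubes with
centres `p u` and `p v`, and meets no shadow of a cube of the family `S` at a height in between. -/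
def LineVisible {V ι : Type*} (p : V → ι → ℝ) (i : ι) (S : Set V) (u v : V) : Prop :=
  ∃ z : ι → ℝ, (∀ j, j ≠ i → |z j - p u j| < 1 / 2 ∧ |z j - p v j| < 1 / 2) ∧
    ∀ w ∈ S, w ≠ u → w ≠ v → p w i ∈ Set.uIcc (p u i) (p v i) →
      ∃ j, j ≠ i ∧ 1 / 2 < |z j - p w j|

/-- The unit cubes orthogonal to the `i`-th axis with centres `a` and `b` are disjoint. -/
def Separated {ι : Type*} (i : ι) (a b : ι → ℝ) : Prop :=
  a i ≠ b i ∨ ∃ j, j ≠ i ∧ 1 < |a j - b j|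

theorem LineVisible.symm {V ι : Type*} {p : V → ι → ℝ} {i : ι} {S : Set V} {u v : V}
    (h : LineVisible p i S u v) : LineVisible p i S v u := by
  obtain ⟨z, hz, hw⟩ := h
  refine ⟨z, fun j hj => (hz j hj).symm, fun w hS hu hv hI => hw w hS hv hu ?_⟩
  rwa [Set.uIcc_comm]

theorem LineVisible.mono {V ι : Type*} {p : V → ι → ℝ} {i : ι} {S S' : Set V} {u v : V}
    (hS : S' ⊆ S) (h : LineVisible p i S u v) : LineVisible p i S' u v := by
  obtain ⟨z, hz, hw⟩ := h
  exact ⟨z, hz, fun w hw' => hw w (hS hw')⟩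

theorem Separated.ne_of_close {ι : Type*} {i : ι} {a b z : ι → ℝ} (h : Separated i a b)
    (hz : ∀ j, j ≠ i → |z j - a j| ≤ 1 / 2 ∧ |z j - b j| ≤ 1 / 2) : a i ≠ b i := by
  rcases h with h | ⟨j, hj, h⟩
  · exact h
  · have h1 := abs_le.1 (hz j hj).1
    have h2 := abs_le.1 (hz j hj).2
    rcases lt_abs.1 h with h | h <;> linarith

theorem abs_sub_le_one_of_close {x a b : ℝ} (h1 : |x - a| ≤ 1 / 2) (h2 : |x - b| ≤ 1 / 2) :
    |a - b| ≤ 1 := by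
  rw [abs_le] at *
  constructor <;> linarith

/-! ### From channels to lines -/

theorem update_mem_disk {d : ℕ} (i : Fin d) (z : Fin d → ℝ) {r : ℝ} (hr : 0 < r) (h : ℝ) :
    Function.update z i h ∈ disk i z r h := by
  refine ⟨by simp, ?_⟩
  rw [Finset.sum_eq_zero]
  · positivity
  · intro j hj
    simp [Function.update_of_ne (Finset.ne_of_mem_erase hj)]

theorem lt_half_of_disk_subset {d : ℕ} {i : Fin d} {z a : Fin d → ℝ} {r h : ℝ} (hr : 0 < r)
    (hsub : ∀ x ∈ disk i z r h, ∀ j, j ≠ i → |x j - a j| ≤ 1 / 2) (j : Fin d) (hj : j ≠ i) :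
    |z j - a j| < 1 / 2 := by
  have key : ∀ e : ℝ, e ^ 2 < r ^ 2 → |z j + e - a j| ≤ 1 / 2 := by
    intro e he
    have := hsub (Function.update (Function.update z i h) j (z j + e)) ?_ j hj
    · simpa using this
    · refine ⟨by simp [Function.update_of_ne hj.symm], ?_⟩
      rw [Finset.sum_eq_single j]
      · simpa using he
      · intro k hk hkj
        simp [Function.update_of_ne hkj, Function.update_of_ne (Finset.ne_of_mem_erase hk)]
      · intro hn
        exact absurd (Finset.mem_erase.2 ⟨hj, Finset.mem_univ j⟩) hn
  -- Points of the disk on both sides of `z j` make the inequality strict.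
  have h1 := abs_le.1 (key (r / 2) (by nlinarith))
  have h2 := abs_le.1 (key (-(r / 2)) (by nlinarith))
  rw [abs_lt]
  constructor <;> linarith

theorem abs_sub_lt_of_mem_disk {d : ℕ} {i : Fin d} {z x : Fin d → ℝ} {r h : ℝ} (hr : 0 < r)
    (hx : x ∈ disk i z r h) (j : Fin d) (hj : j ≠ i) : |x j - z j| < r := by
  have h1 : (x j - z j) ^ 2 ≤ ∑ k ∈ Finset.univ.erase i, (x k - z k) ^ 2 :=
    Finset.single_le_sum (f := fun k => (x k - z k) ^ 2) (fun k _ => sq_nonneg _)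
      (Finset.mem_erase.2 ⟨hj, Finset.mem_univ j⟩)
  exact abs_lt_of_sq_lt_sq (lt_of_le_of_lt h1 hx.2) hr.le

/-- A radius so small that a disk around `z` does not cross the boundary of the shadow of any cube
of the family whose boundary does not contain `z`. -/
theorem exists_radius {V ι : Type*} [Finite V] [Finite ι] (p : V → ι → ℝ) (z : ι → ℝ) :
    ∃ r : ℝ, 0 < r ∧ ∀ w j, (|z j - p w j| < 1 / 2 → |z j - p w j| + r ≤ 1 / 2) ∧
      (1 / 2 < |z j - p w j| → 1 / 2 + r ≤ |z j - p w j|) := by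
  have key : ∀ᶠ r : ℝ in 𝓝[>] 0, ∀ w j,
      (|z j - p w j| < 1 / 2 → |z j - p w j| + r ≤ 1 / 2) ∧
      (1 / 2 < |z j - p w j| → 1 / 2 + r ≤ |z j - p w j|) := by
    refine eventually_all.2 fun w => eventually_all.2 fun j => ?_
    have h : ∀ e : ℝ, 0 < e → ∀ᶠ r : ℝ in 𝓝[>] 0, r < e := fun e he =>
      nhdsWithin_le_nhds (eventually_lt_nhds he)
    rcases lt_trichotomy (|z j - p w j|) (1 / 2) with h1 | h1 | h1
    · filter_upwards [h _ (sub_pos.2 h1)] with r hr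
      exact ⟨fun _ => by linarith, fun _ => by linarith⟩
    · exact Eventually.of_forall fun r => ⟨fun _ => by linarith, fun _ => by linarith⟩
    · filter_upwards [h _ (sub_pos.2 h1)] with r hr
      exact ⟨fun _ => by linarith, fun _ => by linarith⟩
  obtain ⟨r, hr, hr'⟩ := (key.and self_mem_nhdsWithin).exists
  exact ⟨r, hr', hr⟩

theorem disjoint_orthCube_iff {m : ℕ} (a b : Fin (m + 1) → ℝ) :
    Disjoint (orthCube a) (orthCube b) ↔ Separated (Fin.last m) a b := by
  constructor
  · intro h
    by_contra hn
    simp only [Separated, not_or, not_not, not_exists, not_and, not_lt] at hn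
    obtain ⟨hl, hj⟩ := hn
    have h' := Set.disjoint_left.1 h
    refine @h' (fun j => (a j + b j) / 2) ⟨fun j hji => ?_, ?_⟩
      ⟨fun j hji => ?_, ?_⟩
    · have := abs_le.1 (hj j hji)
      rw [abs_le]; constructor <;> linarith
    · simp [hl]
    · have := abs_le.1 (hj j hji)
      rw [abs_le]; constructor <;> linarith
    · simp [hl]
  · intro h
    refine Set.disjoint_left.2 fun x hxa hxb => ?_
    exact h.ne_of_close (fun j hj => ⟨hxa.1 j hj, hxb.1 j hj⟩) (hxa.2.symm.trans hxb.2)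

theorem disjoint_cube_iff {d : ℕ} (a b : Fin d → ℝ) :
    Disjoint (cube a) (cube b) ↔ ∃ j, 1 < |a j - b j| := by
  constructor
  · intro h
    by_contra! hn
    have h' := Set.disjoint_left.1 h
    refine @h' (fun j => (a j + b j) / 2) (fun j => ?_) (fun j => ?_) <;>
    · have := abs_le.1 (hn j)
      rw [abs_le]; constructor <;> linarith
  · rintro ⟨j, hj⟩
    refine Set.disjoint_left.2 fun x hxa hxb => ?_
    exact absurd (abs_sub_le_one_of_close (hxa j) (hxb j)) (not_le.2 hj)

theorem sees_orthCube_iff {V : Type*} [Finite V] {m : ℕ} (c : V → Fin (m + 1) → ℝ) (u v : V) :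
    Sees (fun w => orthCube (c w)) (Fin.last m) u v ↔
      LineVisible c (Fin.last m) Set.univ u v := by
  constructor
  · rintro ⟨z, r, s, t, hr, hu, hv, hw⟩
    have hs : s = c u (Fin.last m) := by
      simpa using (hu (update_mem_disk _ z hr s)).2
    have ht : t = c v (Fin.last m) := by
      simpa using (hv (update_mem_disk _ z hr t)).2
    refine ⟨z, fun j hj => ⟨lt_half_of_disk_subset hr (fun x hx => (hu hx).1) j hj,
      lt_half_of_disk_subset hr (fun x hx => (hv hx).1) j hj⟩, fun w _ hwu hwv hI => ?_⟩
    by_contra! hn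
    refine Set.disjoint_left.1 (hw w hwu hwv)
      (Set.mem_iUnion₂.2 ⟨c w (Fin.last m), ?_, update_mem_disk _ z hr _⟩) ⟨fun j hj => ?_, ?_⟩
    · rwa [hs, ht]
    · rw [Function.update_of_ne hj]; exact hn j hj
    · simp
  · rintro ⟨z, hz, hw⟩
    obtain ⟨r, hr, hr'⟩ := exists_radius c z
    have hsub : ∀ w, (∀ j, j ≠ Fin.last m → |z j - c w j| < 1 / 2) →
        disk (Fin.last m) z r (c w (Fin.last m)) ⊆ orthCube (c w) := by
      refine fun w hzw x hx => ⟨fun j hj => ?_, hx.1⟩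
      have h1 := abs_sub_lt_of_mem_disk hr hx j hj
      have h2 := (hr' w j).1 (hzw j hj)
      linarith [abs_sub_le (x j) (z j) (c w j)]
    refine ⟨z, r, _, _, hr, hsub u fun j hj => (hz j hj).1, hsub v fun j hj => (hz j hj).2,
      fun w hwu hwv => Set.disjoint_left.2 fun x hx hxw => ?_⟩
    obtain ⟨h, hh, hx⟩ := Set.mem_iUnion₂.1 hx
    obtain ⟨j, hj, hjw⟩ := hw w trivial hwu hwv (by rwa [← hxw.2, hx.1])
    have h1 := abs_sub_lt_of_mem_disk hr hx j hj
    have h2 := (hr' w j).2 hjw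
    have h3 := hxw.1 j hj
    rw [abs_sub_comm] at h1
    linarith [abs_sub_le (z j) (x j) (c w j)]

/-- Thickness along axis `i` is harmless: by disjointness, cubes met by a common line have centres
more than 1 apart in that direction. -/
theorem sees_cube_iff {V : Type*} [Finite V] {d : ℕ} (c : V → Fin d → ℝ)
    (hc : ∀ u v, u ≠ v → Disjoint (cube (c u)) (cube (c v))) (i : Fin d) (u v : V) :
    Sees (fun w => cube (c w)) i u v ↔ LineVisible c i Set.univ u v := by
  have far : ∀ (z : Fin d → ℝ) a b, a ≠ b → (∀ j, j ≠ i → |z j - c a j| ≤ 1 / 2) →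
      (∀ j, j ≠ i → |z j - c b j| ≤ 1 / 2) → 1 < |c a i - c b i| := by
    intro z a b hab ha hb
    obtain ⟨j, hj⟩ := (disjoint_cube_iff _ _).1 (hc a b hab)
    rcases eq_or_ne j i with rfl | hji
    · exact hj
    · exact absurd (abs_sub_le_one_of_close (ha j hji) (hb j hji)) (not_le.2 hj)
  constructor
  · rintro ⟨z, r, s, t, hr, hu, hv, hw⟩
    have hs : |s - c u i| ≤ 1 / 2 := by
      simpa using hu (update_mem_disk _ z hr s) i
    have ht : |t - c v i| ≤ 1 / 2 := by
      simpa using hv (update_mem_disk _ z hr t) i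
    have hzu := lt_half_of_disk_subset hr (fun x hx j _ => hu hx j)
    have hzv := lt_half_of_disk_subset hr (fun x hx j _ => hv hx j)
    refine ⟨z, fun j hj => ⟨hzu j hj, hzv j hj⟩, fun w _ hwu hwv hI => ?_⟩
    by_contra! hn
    have h1 := far z w u hwu hn fun j hj => (hzu j hj).le
    have h2 := far z w v hwv hn fun j hj => (hzv j hj).le
    refine Set.disjoint_left.1 (hw w hwu hwv)
      (Set.mem_iUnion₂.2 ⟨c w i, ?_, update_mem_disk _ z hr _⟩) fun j => ?_
    -- The centre of `w` is more than 1 from those of `u` and `v`, and `s`, `t` are within 1/2 of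
    -- the latter, so it also lies between `s` and `t`.
    · rw [abs_le] at hs ht
      rw [Set.mem_uIcc] at hI ⊢
      rcases lt_abs.1 h1 with h1 | h1 <;> rcases lt_abs.1 h2 with h2 | h2 <;>
        rcases hI with hI | hI <;>
        first
          | (left; constructor <;> linarith)
          | (right; constructor <;> linarith)
    · rcases eq_or_ne j i with rfl | hj
      · simp
      · rw [Function.update_of_ne hj]; exact hn j hj
  · rintro ⟨z, hz, hw⟩
    obtain ⟨r, hr, hr'⟩ := exists_radius c z
    have hsub : ∀ w, (∀ j, j ≠ i → |z j - c w j| < 1 / 2) →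
        disk i z r (c w i) ⊆ cube (c w) := by
      intro w hzw x hx j
      rcases eq_or_ne j i with rfl | hj
      · simp [hx.1]
      have h1 := abs_sub_lt_of_mem_disk hr hx j hj
      have h2 := (hr' w j).1 (hzw j hj)
      linarith [abs_sub_le (x j) (z j) (c w j)]
    refine ⟨z, r, _, _, hr, hsub u fun j hj => (hz j hj).1, hsub v fun j hj => (hz j hj).2,
      fun w hwu hwv => Set.disjoint_left.2 fun x hx hxw => ?_⟩
    obtain ⟨h, hh, hx⟩ := Set.mem_iUnion₂.1 hx
    have hzw : ∀ j, j ≠ i → |z j - c w j| ≤ 1 / 2 := by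
      intro j hj
      by_contra! hjw
      have h1 := abs_sub_lt_of_mem_disk hr hx j hj
      have h2 := (hr' w j).2 hjw
      have h3 := hxw j
      rw [abs_sub_comm] at h1
      linarith [abs_sub_le (z j) (x j) (c w j)]
    have h1 := far z w u hwu hzw fun j hj => (hz j hj).1.le
    have h2 := far z w v hwv hzw fun j hj => (hz j hj).2.le
    have hI : c w i ∉ Set.uIcc (c u i) (c v i) := fun hI => by
      obtain ⟨j, hj, hjw⟩ := hw w trivial hwu hwv hI
      exact absurd (hzw j hj) (not_le.2 hjw)
    have hxi := hxw i
    rw [hx.1] at hxi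
    rw [abs_le] at hxi
    rw [Set.mem_uIcc] at hI hh
    apply hI
    -- A channel height within 1/2 of the centre of `w`, together with the two gaps above 1, forces
    -- that centre between the other two.
    rcases lt_abs.1 h1 with h1 | h1 <;> rcases lt_abs.1 h2 with h2 | h2 <;>
      rcases hh with hh | hh <;>
      first
        | (exfalso; linarith)
        | (left; constructor <;> linarith)
        | (right; constructor <;> linarith)

/-! ### Generic lines and paths of the visibility graph -/

/-- Within the tolerance left by strict inequalities, a point can be moved off all boundaries of the
shadows of a finite family of cubes. -/
theorem exists_generic {V ι : Type*} [Finite V] (p : V → ι → ℝ) (z : ι → ℝ) :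
    ∃ z' : ι → ℝ, ∀ w j, (|z j - p w j| < 1 / 2 → |z' j - p w j| < 1 / 2) ∧
      (1 / 2 < |z j - p w j| → 1 / 2 < |z' j - p w j|) ∧ |z' j - p w j| ≠ 1 / 2 := by
  have key : ∀ j, ∃ y : ℝ, ∀ w, (|z j - p w j| < 1 / 2 → |y - p w j| < 1 / 2) ∧
      (1 / 2 < |z j - p w j| → 1 / 2 < |y - p w j|) ∧ |y - p w j| ≠ 1 / 2 := by
    intro j
    -- Strict inequalities persist near `z j`; the one-sided neighbourhood excludes `z j` itself,
    -- which may be a boundary value.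
    have : ∀ᶠ y : ℝ in 𝓝[>] (z j), ∀ w, (|z j - p w j| < 1 / 2 → |y - p w j| < 1 / 2) ∧
        (1 / 2 < |z j - p w j| → 1 / 2 < |y - p w j|) ∧ |y - p w j| ≠ 1 / 2 := by
      refine eventually_all.2 fun w => ?_
      have hcont : Tendsto (fun y : ℝ => |y - p w j|) (𝓝[>] (z j)) (𝓝 |z j - p w j|) := by
        have : Continuous fun y : ℝ => |y - p w j| := by fun_prop
        exact (this.tendsto (z j)).mono_left nhdsWithin_le_nhds
      have hne : ∀ a : ℝ, ∀ᶠ y : ℝ in 𝓝[>] (z j), y ≠ a := by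
        intro a
        rcases eq_or_ne (z j) a with rfl | h
        · filter_upwards [self_mem_nhdsWithin] with y hy using ne_of_gt hy
        · exact nhdsWithin_le_nhds (isOpen_ne.mem_nhds h)
      refine Eventually.and ?_ (Eventually.and ?_ ?_)
      · by_cases h : |z j - p w j| < 1 / 2
        · filter_upwards [hcont.eventually_lt_const h] with y hy _ using hy
        · exact Eventually.of_forall fun y hy => absurd hy h
      · by_cases h : 1 / 2 < |z j - p w j|
        · filter_upwards [hcont.eventually_const_lt h] with y hy _ using hy
        · exact Eventually.of_forall fun y hy => absurd hy h
      · filter_upwards [hne (p w j + 1 / 2), hne (p w j - 1 / 2)] with y h1 h2 h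
        rcases (abs_eq (by norm_num)).1 h with h | h
        · exact h1 (by linarith)
        · exact h2 (by linarith)
    exact this.exists
  choose z' hz' using key
  exact ⟨z', fun w j => hz' j w⟩

/-- The cubes met by a generic line, between two of them, lie on a path of the visibility graph. -/
theorem exists_isPath_of_line {V ι : Type*} [Finite V] {G : SimpleGraph V} {p : V → ι → ℝ} {i : ι}
    {S : Set V}
    (hsep : ∀ u ∈ S, ∀ v ∈ S, u ≠ v → Separated i (p u) (p v))
    (hG : ∀ u ∈ S, ∀ v ∈ S, u ≠ v → LineVisible p i S u v → G.Adj u v)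
    {z : ι → ℝ} (hz : ∀ w j, |z j - p w j| ≠ 1 / 2) {u : V} (huS : u ∈ S)
    (hu : ∀ j, j ≠ i → |z j - p u j| < 1 / 2) (v : V) (hvS : v ∈ S)
    (hv : ∀ j, j ≠ i → |z j - p v j| < 1 / 2) (huv : p u i ≤ p v i) :
    ∃ q : G.Walk u v, q.IsPath ∧ (∀ x ∈ q.support, p x i ≤ p v i) ∧
      ∀ w ∈ S, (∀ j, j ≠ i → |z j - p w j| < 1 / 2) → p u i ≤ p w i → p w i ≤ p v i →
        w ∈ q.support := by
  have inj : ∀ a ∈ S, ∀ b ∈ S, (∀ j, j ≠ i → |z j - p a j| < 1 / 2) →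
      (∀ j, j ≠ i → |z j - p b j| < 1 / 2) → p a i = p b i → a = b := by
    intro a haS b hbS ha hb hab
    by_contra hne
    exact (hsep a haS b hbS hne).ne_of_close (fun j hj => ⟨(ha j hj).le, (hb j hj).le⟩) hab
  have wf : WellFounded fun a b : V => p a i < p b i :=
    @Finite.wellFounded_of_trans_of_irrefl V _ _ ⟨fun _ _ _ h1 h2 => lt_trans h1 h2⟩
      ⟨fun _ h => lt_irrefl _ h⟩
  induction v using wf.induction with
  | _ v ih =>
    rcases eq_or_lt_of_le huv with heq | hlt
    · obtain rfl := inj u huS v hvS hu hv heq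
      refine ⟨.nil, .nil, by simp, fun w hwS hw h1 h2 => ?_⟩
      simp [inj w hwS u huS hw hu (le_antisymm h2 h1)]
    let L : Set V := {w | w ∈ S ∧ (∀ j, j ≠ i → |z j - p w j| < 1 / 2) ∧ p u i ≤ p w i ∧
      p w i < p v i}
    obtain ⟨v', ⟨hvS', hv', huv', hlt'⟩, hmax⟩ :=
      Set.exists_max_image L (fun w => p w i) (Set.toFinite L) ⟨u, huS, hu, le_rfl, hlt⟩
    obtain ⟨q, hq, hq1, hq2⟩ := ih v' hlt' hvS' hv' huv'
    -- `v'` is the highest cube on the line below `v`. By genericity a blocker would be met in its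
    -- interior, so it would belong to `L` or be at the height of `v`.
    have hadj : G.Adj v' v := by
      refine hG v' hvS' v hvS (fun h => by rw [h] at hlt'; exact lt_irrefl _ hlt')
        ⟨z, fun j hj => ⟨hv' j hj, hv j hj⟩, fun w hwS hwv' hwv hI => ?_⟩
      rw [Set.uIcc_of_le hlt'.le] at hI
      by_contra! hn
      have hw : ∀ j, j ≠ i → |z j - p w j| < 1 / 2 := fun j hj =>
        lt_of_le_of_ne (hn j hj) (hz w j)
      have h2 : p w i < p v i :=
        lt_of_le_of_ne hI.2 fun h => hwv (inj w hwS v hvS hw hv h)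
      have h1 := hmax w ⟨hwS, hw, huv'.trans hI.1, h2⟩
      exact hwv' (inj w hwS v' hvS' hw hv' (le_antisymm h1 hI.1))
    refine ⟨q.concat hadj, hq.concat (fun h => absurd (hq1 v h) (not_le.2 hlt')) hadj, ?_, ?_⟩
    · intro x hx
      rw [SimpleGraph.Walk.support_concat, List.mem_append] at hx
      rcases hx with hx | hx
      · exact (hq1 x hx).trans hlt'.le
      · rw [List.mem_singleton.1 hx]
    · intro w hwS hw h1 h2
      rw [SimpleGraph.Walk.support_concat, List.mem_append]
      rcases eq_or_lt_of_le h2 with h2 | h2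
      · exact Or.inr (List.mem_singleton.2 (inj w hwS v hvS hw hv h2))
      · exact Or.inl (hq2 w hwS hw h1 (hmax w ⟨hwS, hw, h1, h2⟩))

/-- Visibility within a subfamily that is closed under taking paths of the visibility graph is
visibility within the whole family. -/
theorem LineVisible.of_subfamily {V ι : Type*} [Finite V] {G : SimpleGraph V} {p : V → ι → ℝ}
    {i : ι} {S S' : Set V} (hS : S' ⊆ S)
    (hsep : ∀ u ∈ S, ∀ v ∈ S, u ≠ v → Separated i (p u) (p v))
    (hG : ∀ u ∈ S, ∀ v ∈ S, u ≠ v → LineVisible p i S u v → G.Adj u v)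
    (hpath : ∀ u ∈ S', ∀ v ∈ S', ∀ q : G.Walk u v, q.IsPath → ∀ x ∈ q.support, x ∈ S')
    {u v : V} (hu : u ∈ S') (hv : v ∈ S') (h : LineVisible p i S' u v) :
    LineVisible p i S u v := by
  wlog huv : p u i ≤ p v i generalizing u v
  · exact (this hv hu h.symm (not_le.1 huv).le).symm
  obtain ⟨z, hz, hw⟩ := h
  -- The original line may graze a cube outside `S'`. The generic one meets the interior of every
  -- shadow that it meets, so a blocker lies on a path between `u` and `v`, hence in `S'`, where the
  -- original line already excludes it.
  obtain ⟨z', hz'⟩ := exists_generic p z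
  have hzu : ∀ j, j ≠ i → |z' j - p u j| < 1 / 2 := fun j hj => (hz' u j).1 (hz j hj).1
  have hzv : ∀ j, j ≠ i → |z' j - p v j| < 1 / 2 := fun j hj => (hz' v j).1 (hz j hj).2
  refine ⟨z', fun j hj => ⟨hzu j hj, hzv j hj⟩, fun w hwS hwu hwv hI => ?_⟩
  by_contra! hn
  obtain ⟨q, hq, -, hq2⟩ := exists_isPath_of_line hsep hG (fun w j => (hz' w j).2.2) (hS hu) hzu v
    (hS hv) hzv huv
  have hI' := hI
  rw [Set.uIcc_of_le huv] at hI'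
  have hwS' : w ∈ S' := hpath u hu v hv q hq w
    (hq2 w hwS (fun j hj => lt_of_le_of_ne (hn j hj) (hz' w j).2.2) hI'.1 hI'.2)
  obtain ⟨j, hj, hjw⟩ := hw w hwS' hwu hwv hI
  exact absurd ((hz' w j).2.1 hjw) (not_lt.2 (hn j hj))

/-! ### Representations of forests and of their subforests -/

/-- The unit cubes orthogonal to the `i`-th axis with centres `p v` represent each connected
component of `G` as a visibility graph. -/
def Represents {V ι : Type*} (G : SimpleGraph V) (i : ι) (p : V → ι → ℝ) : Prop :=
  ∀ u v, u ≠ v → G.Reachable u v → Separated i (p u) (p v) ∧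
    (G.Adj u v ↔ LineVisible p i {w | G.Reachable u w} u v)

/-- Paths in a forest are unique, so the path that `H` provides is the given one. -/
theorem eq_mapLe_of_isPath {V : Type*} {G H : SimpleGraph V} (hG : G.IsAcyclic) (hHG : H ≤ G)
    {u v : V} (h : H.Reachable u v) {q : G.Walk u v} (hq : q.IsPath) :
    ∃ q' : H.Walk u v, q = q'.mapLe hHG := by
  obtain ⟨q', hq'⟩ := h.exists_isPath
  exact ⟨q', Subtype.mk.inj ((hG.subsingleton_path u v).elim ⟨q, hq⟩ ⟨_, hq'.mapLe hHG⟩)⟩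

theorem adj_of_reachable_of_le {V : Type*} {G H : SimpleGraph V} (hG : G.IsAcyclic) (hHG : H ≤ G)
    {u v : V} (h : H.Reachable u v) (hadj : G.Adj u v) : H.Adj u v := by
  obtain ⟨q, hq⟩ := eq_mapLe_of_isPath hG hHG h (SimpleGraph.Path.singleton hadj).2
  refine q.adj_of_length_eq_one ?_
  have h2 := congrArg SimpleGraph.Walk.length hq
  rw [SimpleGraph.Walk.length_mapLe] at h2
  rw [← h2]
  rfl

theorem reachable_of_mem_support {V : Type*} {G : SimpleGraph V} {u v x : V} (q : G.Walk u v)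
    (hx : x ∈ q.support) : G.Reachable u x := by
  classical
  exact ⟨q.takeUntil x hx⟩

/-- The unique path of `G` between two vertices of a component of `H` stays in that component, so
restricting to it opens no new view. An edge of `G` joining two vertices of the component belongs to
`H` by the same uniqueness. -/
theorem Represents.anti {V ι : Type*} [Finite V] {G H : SimpleGraph V} (hG : G.IsAcyclic)
    (hHG : H ≤ G) {i : ι} {p : V → ι → ℝ} (h : Represents G i p) : Represents H i p := by
  intro u v huv hr
  have hrG := hr.mono hHG
  refine ⟨(h u v huv hrG).1, fun hadj => ?_, fun hvis => ?_⟩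
  · exact ((h u v huv hrG).2.1 (hHG hadj)).mono fun w (hw : H.Reachable u w) => hw.mono hHG
  · refine adj_of_reachable_of_le hG hHG hr ((h u v huv hrG).2.2 ?_)
    have hG' : ∀ a b, G.Reachable u a → G.Reachable u b → G.Reachable a b :=
      fun a b ha hb => ha.symm.trans hb
    refine hvis.of_subfamily (G := G) (fun w (hw : H.Reachable u w) => hw.mono hHG)
      (fun a ha b hb hab => (h a b hab (hG' a b ha hb)).1)
      (fun a ha b hb hab hv => (h a b hab (hG' a b ha hb)).2.2 (hv.mono ?_)) ?_
      (SimpleGraph.Reachable.refl u) hr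
    · exact fun w hw => SimpleGraph.Reachable.trans ha hw
    · intro a (ha : H.Reachable u a) b (hb : H.Reachable u b) q hq x hx
      obtain ⟨q', rfl⟩ := eq_mapLe_of_isPath hG hHG (ha.symm.trans hb) hq
      rw [SimpleGraph.Walk.support_mapLe_eq_support] at hx
      exact ha.trans (reachable_of_mem_support q' hx)

/-- A walk never leaves its component, so discarding the other components opens no new view. -/
theorem represents_of_forall {V ι : Type*} [Finite V] {G : SimpleGraph V} {i : ι} {p : V → ι → ℝ}
    (hsep : ∀ u v, u ≠ v → Separated i (p u) (p v))
    (hG : ∀ u v, u ≠ v → (G.Adj u v ↔ LineVisible p i Set.univ u v)) : Represents G i p := by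
  intro u v huv hr
  refine ⟨hsep u v huv, fun h => ((hG u v huv).1 h).mono (Set.subset_univ _), fun h => ?_⟩
  refine (hG u v huv).2 (h.of_subfamily (G := G) (Set.subset_univ _) (fun a _ b _ => hsep a b)
    (fun a _ b _ hab => (hG a b hab).2) ?_ (SimpleGraph.Reachable.refl u) hr)
  intro a (ha : G.Reachable u a) b _ q _ x hx
  exact ha.trans (reachable_of_mem_support q hx)

/-- Relabelling of the axes. -/
theorem Represents.comp_equiv {V ι κ : Type*} {G : SimpleGraph V} {i : ι} {p : V → ι → ℝ}
    (h : Represents G i p) (e : κ ≃ ι) {k : κ} (hk : e k = i) :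
    Represents G k fun v j => p v (e j) := by
  subst hk
  intro u v huv hr
  obtain ⟨h1, h2⟩ := h u v huv hr
  have hex : ∀ P : ι → Prop, (∃ j, j ≠ e k ∧ P j) ↔ ∃ j, j ≠ k ∧ P (e j) := fun P =>
    ⟨fun ⟨j, hj, hP⟩ => ⟨e.symm j, fun h => hj (by simp [← h]), by simpa using hP⟩,
      fun ⟨j, hj, hP⟩ => ⟨e j, fun h => hj (e.injective h), hP⟩⟩
  refine ⟨?_, h2.trans ⟨?_, ?_⟩⟩
  · rcases h1 with h1 | h1
    · exact Or.inl h1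
    · exact Or.inr ((hex fun j => 1 < |p u j - p v j|).1 h1)
  · rintro ⟨z, hz, hw⟩
    exact ⟨fun j => z (e j), fun j hj => hz (e j) fun h => hj (e.injective h),
      fun w hwS hwu hwv hI => (hex fun j => 1 / 2 < |z j - p w j|).1 (hw w hwS hwu hwv hI)⟩
  · rintro ⟨z, hz, hw⟩
    refine ⟨fun j => z (e.symm j), fun j hj => ?_,
      fun w hwS hwu hwv hI => (hex fun j => 1 / 2 < |z (e.symm j) - p w j|).2 ?_⟩
    · simpa using hz (e.symm j) fun h => hj (by simp [← h])
    · simpa using hw w hwS hwu hwv hI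

/-- `Represents` puts no condition on pairs from different components, so the separate
representations merge into one function even if they overlap in space. -/
theorem isOrthVisibilityForest_iff {V : Type*} [Finite V] (m : ℕ) {G : SimpleGraph V}
    (hac : G.IsAcyclic) :
    IsOrthVisibilityForest m G ↔ ∃ p : V → Fin (m + 1) → ℝ, Represents G (Fin.last m) p := by
  have hadj : ∀ (C : G.ConnectedComponent) (a b : C),
      C.toSimpleGraph.Adj a b ↔ G.Adj a b := fun C a b => Iff.rfl
  constructor
  · intro h
    choose c hc1 hc2 using fun C => (h C).2
    obtain ⟨p, hp⟩ : ∃ p : V → Fin (m + 1) → ℝ,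
        ∀ v, p v = c (G.connectedComponentMk v) ⟨v, rfl⟩ := ⟨_, fun v => rfl⟩
    refine ⟨p, fun u v huv hr => ?_⟩
    have hcv : ∀ (C : G.ConnectedComponent) (w : V) (hw : G.connectedComponentMk w = C),
        p w = c C ⟨w, hw⟩ := by
      rintro _ w rfl; exact hp w
    have hvC : G.connectedComponentMk v = G.connectedComponentMk u :=
      (SimpleGraph.ConnectedComponent.sound hr).symm
    generalize hC : G.connectedComponentMk u = C at hvC
    have hne : (⟨u, hC⟩ : C) ≠ ⟨v, hvC⟩ := fun h => huv (congrArg Subtype.val h)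
    rw [hcv C u hC, hcv C v hvC]
    refine ⟨(disjoint_orthCube_iff _ _).1 (hc1 C _ _ hne), ?_⟩
    rw [← hadj C ⟨u, hC⟩ ⟨v, hvC⟩, hc2 C _ _ hne, sees_orthCube_iff]
    have hmem : ∀ w, G.Reachable u w ↔ G.connectedComponentMk w = C := by
      intro w
      rw [← hC, SimpleGraph.ConnectedComponent.eq]
      exact ⟨.symm, .symm⟩
    simp only [LineVisible, hcv C u hC, hcv C v hvC]
    refine exists_congr fun z => and_congr_right fun _ => ⟨fun hw w hwS hwu hwv => ?_,
      fun hw w _ hwu hwv => ?_⟩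
    · rw [hcv C w ((hmem w).1 hwS)]
      exact hw _ trivial (fun h => hwu (congrArg Subtype.val h))
        (fun h => hwv (congrArg Subtype.val h))
    · have := hw w ((hmem w).2 w.2) (fun h => hwu (Subtype.ext h)) (fun h => hwv (Subtype.ext h))
      rwa [hcv C w w.2] at this
  · rintro ⟨p, hp⟩ C
    refine ⟨hac.isTree_connectedComponent C, fun v => p v, fun u v huv => ?_, fun u v huv => ?_⟩
    · have hr : G.Reachable u v := SimpleGraph.ConnectedComponent.exact (u.2.trans v.2.symm)
      exact (disjoint_orthCube_iff _ _).2 (hp u v (fun h => huv (Subtype.ext h)) hr).1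
    · have hr : G.Reachable u v := SimpleGraph.ConnectedComponent.exact (u.2.trans v.2.symm)
      rw [hadj, (hp u v (fun h => huv (Subtype.ext h)) hr).2, sees_orthCube_iff]
      refine exists_congr fun z => and_congr_right fun _ => ⟨fun hw w _ hwu hwv => ?_,
        fun hw w hwS hwu hwv => ?_⟩
      · exact hw w (SimpleGraph.ConnectedComponent.exact (u.2.trans w.2.symm))
          (fun h => hwu (Subtype.ext h)) (fun h => hwv (Subtype.ext h))
      · exact hw ⟨w, (SimpleGraph.ConnectedComponent.sound hwS).symm.trans u.2⟩ trivial
          (fun h => hwu (congrArg Subtype.val h)) (fun h => hwv (congrArg Subtype.val h))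

/-! ### Subgraphs and their spanning versions -/

theorem reachable_coe_iff {V : Type*} {T : SimpleGraph V} (F : T.Subgraph) (u v : F.verts) :
    F.coe.Reachable u v ↔ F.spanningCoe.Reachable u v := by
  constructor
  · intro h
    exact h.map (⟨Subtype.val, fun h => h⟩ : F.coe →g F.spanningCoe)
  · have key : ∀ (a b : V) (_ : F.spanningCoe.Walk a b) (ha : a ∈ F.verts) (hb : b ∈ F.verts),
        F.coe.Reachable ⟨a, ha⟩ ⟨b, hb⟩ := by
      intro a b q
      induction q with
      | nil => exact fun ha hb => .refl _
      | cons hadj q ih =>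
        intro ha hb
        have hadj' : F.Adj _ _ := hadj
        have h1 : F.coe.Adj ⟨_, ha⟩ ⟨_, hadj'.snd_mem⟩ := hadj'
        exact h1.reachable.trans (ih _ hb)
    rintro ⟨q⟩
    exact key u v q u.2 v.2

theorem represents_coe_iff {V ι : Type*} {T : SimpleGraph V} (F : T.Subgraph) (i : ι)
    (p : V → ι → ℝ) :
    Represents F.coe i (fun v => p v) ↔ Represents F.spanningCoe i p := by
  have hmem : ∀ u ∈ F.verts, ∀ v, F.spanningCoe.Reachable u v → v ∈ F.verts := by
    rintro u hu v ⟨q⟩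
    induction q with
    | nil => exact hu
    | cons hadj q ih => exact ih (F.edge_vert (F.adj_symm hadj))
  have key : ∀ u v : F.verts, LineVisible (fun v : F.verts => p v) i {w | F.coe.Reachable u w} u v ↔
      LineVisible p i {w | F.spanningCoe.Reachable u w} u v := by
    intro u v
    refine exists_congr fun z => and_congr_right fun _ => ⟨fun hw w hwS hwu hwv => ?_,
        fun hw w hwS hwu hwv => ?_⟩
    · exact hw ⟨w, hmem u u.2 w hwS⟩ ((reachable_coe_iff F _ _).2 hwS)
        (fun h => hwu (congrArg Subtype.val h)) (fun h => hwv (congrArg Subtype.val h))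
    · exact hw w ((reachable_coe_iff F _ _).1 hwS)
        (fun h => hwu (Subtype.ext h)) (fun h => hwv (Subtype.ext h))
  constructor
  · intro h u v huv hr
    have hu : u ∈ F.verts := by
      obtain ⟨q⟩ := hr
      cases q with
      | nil => exact absurd rfl huv
      | cons hadj q => exact F.edge_vert hadj
    have := h ⟨u, hu⟩ ⟨v, hmem u hu v hr⟩ (fun h => huv (congrArg Subtype.val h))
      ((reachable_coe_iff F _ _).2 hr)
    rw [key] at this
    exact this
  · intro h u v huv hr
    rw [key]
    exact h u v (fun h => huv (Subtype.ext h)) ((reachable_coe_iff F _ _).1 hr)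

/-! ### Coordinates on a tree -/

/-- Prescribed antisymmetric differences along the edges of a tree come from a potential. -/
theorem exists_potential {V : Type*} {T : SimpleGraph V} (hT : T.IsTree) (δ : V → V → ℝ)
    (hδ : ∀ u v, δ u v = -δ v u) : ∃ φ : V → ℝ, ∀ u v, T.Adj u v → φ u - φ v = δ u v := by
  classical
  obtain ⟨r⟩ := hT.connected.nonempty
  choose q hq using fun v => (hT.connected.preconnected r v).exists_isPath
  let s : ∀ {a b : V}, T.Walk a b → ℝ := fun w => (w.darts.map fun d => δ d.snd d.fst).sum
  have hs : ∀ {u v : V} (h : T.Adj u v), q v = (q u).concat h → s (q u) - s (q v) = δ u v := by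
    intro u v h hv
    simp only [s]
    rw [hv, SimpleGraph.Walk.darts_concat]
    simp [hδ u v]
  refine ⟨fun v => s (q v), fun u v h => ?_⟩
  -- Of two adjacent vertices of a tree, one lies on the path from the root to the other.
  by_cases hu : u ∈ (q v).support
  · exact hs h (hT.isAcyclic.path_concat (hq u) (hq v) h hu)
  · have hv : v ∈ (q u).support :=
      hT.isAcyclic.mem_support_of_ne_mem_support_of_adj_of_isPath (hq u) (hq v) h hu
    have := hs h.symm (hT.isAcyclic.path_concat (hq v) (hq u) h.symm hv)
    rw [hδ u v]
    linarith

theorem eq_of_reachable {V α : Type*} {G : SimpleGraph V} {f : V → α}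
    (h : ∀ u v, G.Adj u v → f u = f v) {u v : V} (hr : G.Reachable u v) : f u = f v := by
  obtain ⟨q⟩ := hr
  induction q with
  | nil => rfl
  | cons hadj q ih => exact (h _ _ hadj).trans ih

/-- A function on a tree `T` with edges split into `R` and `H`: it has prescribed differences along
`R`, separates the components of `R`, and is ordered like `f` on the components of `H`. -/
theorem exists_coordinate {V : Type*} [Finite V] {T R H : SimpleGraph V} (hT : T.IsTree)
    (hRT : R ≤ T) (hHT : H ≤ T)
    (hRH : ∀ u v, R.Adj u v → ¬ H.Adj u v) (δ : V → V → ℝ) (hδ : ∀ u v, δ u v = -δ v u)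
    (f : V → ℝ) :
    ∃ a : V → ℝ, (∀ u v, R.Adj u v → a u - a v = δ u v) ∧
      (∀ u v, ¬ R.Reachable u v → 1 < |a u - a v|) ∧
      ∀ u v, H.Reachable u v → f u < f v → a u < a v := by
  classical
  -- `b` has the right differences along `R` but need not separate its components; a function
  -- constant on them is added below.
  obtain ⟨b, hb⟩ := exists_potential hT (fun u v => if H.Adj u v then 0 else δ u v) (by
    intro u v
    by_cases h : H.Adj u v
    · simp [h, h.symm]
    · have h' : ¬ H.Adj v u := fun h' => h h'.symm
      simp [h, h', ← hδ u v])
  -- `t` is constant on components of `R` and differs from `f` by a constant on each component of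
  -- `H`.
  obtain ⟨t, ht⟩ := exists_potential hT (fun u v => if H.Adj u v then f u - f v else 0) (by
    intro u v
    by_cases h : H.Adj u v
    · simp [h, h.symm]
    · have h' : ¬ H.Adj v u := fun h' => h h'.symm
      simp [h, h'])
  obtain ⟨κ, hκ⟩ : ∃ κ : R.ConnectedComponent → ℕ, Function.Injective κ := by
    have := Finite.exists_equiv_fin R.ConnectedComponent
    obtain ⟨k, ⟨e⟩⟩ := this
    exact ⟨fun C => e C, fun C D h => e.injective (Fin.ext h)⟩
  -- `κ` breaks ties of `t`, so `g` takes the same value at two vertices exactly when `R` joins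
  -- them. The rank `ρ` turns its order into integer steps.
  let g : V → ℝ ×ₗ ℕ := fun v => toLex (t v, κ (R.connectedComponentMk v))
  let ρ : V → ℕ := fun v => Set.ncard {w | g w < g v}
  have hρ : ∀ u v, g u < g v → ρ u < ρ v := by
    intro u v h
    refine Set.ncard_lt_ncard ⟨fun w (hw : g w < g u) => hw.trans h, fun hsub => ?_⟩
      (Set.toFinite _)
    exact lt_irrefl (g u) (hsub h)
  have htR : ∀ u v, R.Adj u v → t u = t v := by
    intro u v h
    have := ht u v (hRT h)
    rw [if_neg (hRH u v h)] at this
    linarith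
  have hgR : ∀ u v, R.Adj u v → g u = g v := by
    intro u v h
    simp only [g]
    rw [htR u v h, SimpleGraph.ConnectedComponent.sound h.reachable]
  obtain ⟨B, hB⟩ : ∃ B : ℝ, ∀ v, |b v| ≤ B := by
    obtain ⟨B, hB⟩ := (Set.finite_range fun v => |b v|).bddAbove
    exact ⟨B, fun v => hB ⟨v, rfl⟩⟩
  -- Values of `b` differ by at most `2 * B`, so a step of `2 * B + 2` per rank leaves a gap of at
  -- least 2.
  have hlt : ∀ u v, g u < g v →
      b u + (2 * B + 2) * ρ u + 1 < b v + (2 * B + 2) * ρ v := by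
    intro u v h
    have h1 : (ρ u : ℝ) + 1 ≤ ρ v := by exact_mod_cast hρ u v h
    have h2 := abs_le.1 (hB u)
    have h3 := abs_le.1 (hB v)
    have h4 : (2 * B + 2) * (ρ u + 1) ≤ (2 * B + 2) * ρ v :=
      mul_le_mul_of_nonneg_left h1 (by linarith)
    linarith
  refine ⟨fun v => b v + (2 * B + 2) * ρ v, fun u v h => ?_, fun u v h => ?_,
    fun u v hr h => ?_⟩
  · have h1 := hb u v (hRT h)
    rw [if_neg (hRH u v h)] at h1
    have h2 : ρ u = ρ v := by simp only [ρ, hgR u v h]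
    simp only [h2]
    linarith
  · have hne : g u ≠ g v := by
      intro hg
      exact h (SimpleGraph.ConnectedComponent.exact (hκ (congrArg (fun x => (ofLex x).2) hg)))
    rcases lt_or_gt_of_ne hne with hg | hg
    · have := hlt u v hg
      rw [lt_abs]; right; linarith
    · have := hlt v u hg
      rw [lt_abs]; left; linarith
  · have h1 : t u - f u = t v - f v := by
      refine eq_of_reachable (f := fun v => t v - f v) (fun x y hxy => ?_) hr
      have := ht x y (hHT hxy)
      rw [if_pos hxy] at this
      linarith
    have h2 : g u < g v := Prod.Lex.toLex_lt_toLex.2 (Or.inl (by linarith))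
    have := hlt u v h2
    linarith

/-! ### From cubes to forests -/

theorem exists_forests_of_isVisibilityGraph {V : Type*} [Finite V] {T : SimpleGraph V}
    (hT : T.IsAcyclic) {m : ℕ} (h : IsVisibilityGraph (m + 1) T) :
    ∃ F : Fin (m + 1) → T.Subgraph,
      (∀ i, IsOrthVisibilityForest m (F i).coe) ∧ ⨆ i, F i = ⊤ := by
  obtain ⟨c, hc, hT'⟩ := h
  have hsees := sees_cube_iff c hc
  let G : Fin (m + 1) → SimpleGraph V := fun i =>
    { Adj := fun u v => u ≠ v ∧ LineVisible c i Set.univ u v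
      symm := ⟨fun u v h => ⟨h.1.symm, h.2.symm⟩⟩
      loopless := ⟨fun u h => h.1 rfl⟩ }
  have hG : ∀ i, G i ≤ T := fun i u v h => (hT' u v h.1).2 ⟨i, (hsees i u v).2 h.2⟩
  refine ⟨fun i => SimpleGraph.toSubgraph (G i) (hG i), fun i => ?_, ?_⟩
  · rw [isOrthVisibilityForest_iff m (hT.subgraph _)]
    -- The slices through the centres of the given cubes serve as the representation; a swap of axes
    -- then makes axis `i` the last one.
    have hrep : Represents (G i) i c := by
      refine represents_of_forall (fun u v huv => ?_) fun u v huv => ?_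
      · obtain ⟨j, hj⟩ := (disjoint_cube_iff _ _).1 (hc u v huv)
        rcases eq_or_ne j i with rfl | hji
        · left
          intro h
          rw [h, sub_self, abs_zero] at hj
          linarith
        · exact Or.inr ⟨j, hji, hj⟩
      · exact ⟨fun h => h.2, fun h => ⟨huv, h⟩⟩
    refine ⟨fun v => _, (represents_coe_iff _ _ _).2
      (hrep.comp_equiv (Equiv.swap i (Fin.last m)) (Equiv.swap_apply_right _ _))⟩
  · ext u v
    · simp only [SimpleGraph.Subgraph.verts_iSup, Set.mem_iUnion, SimpleGraph.Subgraph.verts_top,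
        Set.mem_univ, iff_true]
      exact ⟨0, trivial⟩
    · rw [SimpleGraph.Subgraph.iSup_adj, SimpleGraph.Subgraph.top_adj]
      constructor
      · rintro ⟨i, hi⟩
        exact hG i hi
      · intro h
        obtain ⟨i, hi⟩ := (hT' u v h.ne).1 h
        exact ⟨i, h.ne, (hsees i u v).1 hi⟩

/-! ### From forests to cubes -/

/-- Edge-disjoint forests covering a tree, the `i`-th one represented by cubes orthogonal to the
`i`-th axis, are represented simultaneously by unit cubes. -/
theorem isVisibilityGraph_of_represents {V : Type*} [Finite V] {T : SimpleGraph V}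
    (hT : T.IsTree) {d : ℕ} (k : Fin d) (f : Sym2 V → Fin d) (H : Fin d → SimpleGraph V)
    (hH : ∀ i u v, (H i).Adj u v ↔ T.Adj u v ∧ f s(u, v) = i)
    (p : Fin d → V → Fin d → ℝ) (hp : ∀ i, Represents (H i) i (p i)) :
    IsVisibilityGraph d T := by
  have hHT : ∀ i, H i ≤ T := fun i u v h => ((hH i u v).1 h).1
  let R : Fin d → SimpleGraph V := fun i => T \ H i
  have hRT : ∀ i, R i ≤ T := fun i => sdiff_le
  have hR : ∀ i u v, (R i).Adj u v ↔ T.Adj u v ∧ f s(u, v) ≠ i := by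
    intro i u v
    simp only [R, SimpleGraph.sdiff_adj, hH]
    tauto
  have hcoord : ∀ j, ∃ a : V → ℝ, (∀ i u v, i ≠ j → (H i).Adj u v →
      a u - p i u j = a v - p i v j) ∧ (∀ u v, ¬ (R j).Reachable u v → 1 < |a u - a v|) ∧
      ∀ u v, (H j).Reachable u v → p j u j < p j v j → a u < a v := by
    intro j
    -- The difference along an edge is read off from the representation of the forest that has the
    -- colour of the edge.
    obtain ⟨a, h1, h2, h3⟩ := exists_coordinate (R := R j) (H := H j) hT
      (hRT j) (hHT j)
      (fun u v h => by rw [hR] at h; rw [hH]; tauto)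
      (fun u v => p (f s(u, v)) u j - p (f s(u, v)) v j)
      (fun u v => by rw [Sym2.eq_swap]; ring) fun v => p j v j
    refine ⟨a, fun i u v hij hadj => ?_, h2, h3⟩
    rw [hH] at hadj
    have := h1 u v ((hR j u v).2 ⟨hadj.1, by rw [hadj.2]; exact hij⟩)
    rw [hadj.2] at this
    linarith
  choose a ha1 ha2 ha3 using hcoord
  have hdiff : ∀ i j u v, j ≠ i → (H i).Reachable u v → a j u - p i u j = a j v - p i v j :=
    fun i j u v hji hr =>
      eq_of_reachable (f := fun v => a j v - p i v j) (fun x y => ha1 j i x y hji.symm) hr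
  -- An edge of colour `j ≠ i` on the tree path would also lie on the path inside `R j`, which
  -- contains no such edge.
  have hreach : ∀ i u v, (∀ j, j ≠ i → (R j).Reachable u v) → (H i).Reachable u v := by
    intro i u v h
    obtain ⟨q, hq⟩ := (hT.connected.preconnected u v).exists_isPath
    refine ⟨q.transfer (H i) fun e he => ?_⟩
    have heT := q.edges_subset_edgeSet he
    by_contra hn
    have hfe : f e ≠ i := by
      rintro rfl
      induction e with
      | _ x y => exact hn ((hH _ x y).2 ⟨heT, rfl⟩)
    obtain ⟨q', rfl⟩ := eq_mapLe_of_isPath hT.isAcyclic (hRT _) (h _ hfe) hq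
    rw [SimpleGraph.Walk.edges_mapLe_eq_edges] at he
    have := q'.edges_subset_edgeSet he
    induction e with
    | _ x y => exact ((hR _ x y).1 this).2 rfl
  have hnot : ∀ i u v, u ≠ v → (H i).Reachable u v → ¬ (R i).Reachable u v := by
    intro i u v huv hr hr'
    obtain ⟨q, hq⟩ := (hT.connected.preconnected u v).exists_isPath
    obtain ⟨q₁, h₁⟩ := eq_mapLe_of_isPath hT.isAcyclic (hHT i) hr hq
    obtain ⟨q₂, h₂⟩ := eq_mapLe_of_isPath hT.isAcyclic (hRT i) hr' hq
    cases q with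
    | nil => exact huv rfl
    | @cons _ w _ hadj q =>
      have he : s(u, w) ∈ (SimpleGraph.Walk.cons hadj q).edges := by simp
      have he₁ := he
      rw [h₁, SimpleGraph.Walk.edges_mapLe_eq_edges] at he₁
      rw [h₂, SimpleGraph.Walk.edges_mapLe_eq_edges] at he
      exact ((hR i u w).1 (q₂.edges_subset_edgeSet he)).2
        ((hH i u w).1 (q₁.edges_subset_edgeSet he₁)).2
  have hclose : ∀ i u v, (∀ j, j ≠ i → |a j u - a j v| ≤ 1) → (H i).Reachable u v := by
    intro i u v h
    refine hreach i u v fun j hj => ?_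
    by_contra hn
    exact absurd (h j hj) (not_le.2 (ha2 j u v hn))
  have hdisj : ∀ u v, u ≠ v →
      Disjoint (cube fun j => a j u) (cube fun j => a j v) := by
    intro u v huv
    rw [disjoint_cube_iff]
    by_contra! hn
    -- Overlapping cubes are close in every coordinate, so they would be joined both in `H k` and in
    -- `R k`; the first edge of the tree path cannot lie in both.
    have h := hclose k u v fun j _ => hn j
    exact absurd (hn k) (not_le.2 (ha2 k u v (hnot k u v huv h)))
  refine ⟨fun v j => a j v, hdisj, fun u v huv => ?_⟩
  have key : ∀ i, LineVisible (fun v j => a j v) i Set.univ u v ↔ (H i).Adj u v := by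
    intro i
    -- On a component of `H i` the two pictures differ across axis `i` by a fixed translation, which
    -- carries lines of one to lines of the other.
    have hshift : ∀ w, (H i).Reachable u w → ∀ (z : Fin d → ℝ) j, j ≠ i →
        z j - a j u + p i u j - p i w j = z j - a j w := by
      intro w hw z j hj
      have := hdiff i j u w hj hw
      linarith
    have hshift' : ∀ w, (H i).Reachable u w → ∀ (z : Fin d → ℝ) j, j ≠ i →
        z j - p i u j + a j u - a j w = z j - p i w j := by
      intro w hw z j hj
      have := hdiff i j u w hj hw
      linarith
    have hru : (H i).Reachable u u := .refl u
    constructor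
    · rintro ⟨z, hz, hw⟩
      have hr : (H i).Reachable u v := hclose i u v fun j hj =>
        abs_sub_le_one_of_close (hz j hj).1.le (hz j hj).2.le
      obtain ⟨hsep, hadj⟩ := hp i u v huv hr
      refine hadj.2 ⟨fun j => z j - a j u + p i u j, fun j hj => ?_,
        fun w (hwr : (H i).Reachable u w) hwu hwv hI => ?_⟩
      · rw [hshift u hru z j hj, hshift v hr z j hj]
        exact hz j hj
      · by_contra! hn
        have hwz : ∀ j, j ≠ i → |z j - a j w| ≤ 1 / 2 := fun j hj => by
          rw [← hshift w hwr z j hj]; exact hn j hj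
        -- `ha3` preserves only strict order. Equal heights are impossible because the line meets
        -- both slices, which are separated.
        have hne : ∀ x, (H i).Reachable u x → x ≠ w → (∀ j, j ≠ i → |z j - a j x| < 1 / 2) →
            p i x i ≠ p i w i := by
          intro x hx hxw hxz
          refine (hp i x w hxw (hx.symm.trans hwr)).1.ne_of_close
            (z := fun j => z j - a j u + p i u j) fun j hj => ⟨?_, hn j hj⟩
          rw [hshift x hx z j hj]
          exact (hxz j hj).le
        have hu := hne u hru hwu.symm fun j hj => (hz j hj).1
        have hv := hne v hr hwv.symm fun j hj => (hz j hj).2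
        obtain ⟨j, hj, hjw⟩ := hw w trivial hwu hwv (by
          rw [Set.mem_uIcc] at hI ⊢
          rcases hI with hI | hI
          · exact Or.inl ⟨(ha3 i u w hwr (lt_of_le_of_ne hI.1 hu)).le,
              (ha3 i w v (hwr.symm.trans hr) (lt_of_le_of_ne hI.2 hv.symm)).le⟩
          · exact Or.inr ⟨(ha3 i v w (hr.symm.trans hwr) (lt_of_le_of_ne hI.1 hv)).le,
              (ha3 i w u hwr.symm (lt_of_le_of_ne hI.2 hu.symm)).le⟩)
        exact absurd (hwz j hj) (not_le.2 hjw)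
    · intro hadj
      have hr := hadj.reachable
      obtain ⟨hsep, hvis⟩ := hp i u v huv hr
      obtain ⟨z, hz, hw⟩ := hvis.1 hadj
      have hne := hsep.ne_of_close fun j hj => ⟨(hz j hj).1.le, (hz j hj).2.le⟩
      refine ⟨fun j => z j - p i u j + a j u, fun j hj => ?_, fun w _ hwu hwv hI => ?_⟩
      · rw [hshift' u hru z j hj, hshift' v hr z j hj]
        exact hz j hj
      · by_contra! hn
        have hwr : (H i).Reachable u w := hclose i u w fun j hj => by
          refine abs_sub_le_one_of_close (x := z j - p i u j + a j u) ?_ (hn j hj)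
          rw [hshift' u hru z j hj]
          exact (hz j hj).1.le
        -- Betweenness is pulled back by `ha3` in contrapositive form; `hne` fixes which of `u`, `v`
        -- is lower in both pictures.
        obtain ⟨j, hj, hjw⟩ := hw w hwr hwu hwv (by
          rw [Set.mem_uIcc] at hI ⊢
          have h1 := ha3 i u w hwr
          have h2 := ha3 i w u hwr.symm
          have h3 := ha3 i v w (hr.symm.trans hwr)
          have h4 := ha3 i w v (hwr.symm.trans hr)
          have h5 := ha3 i u v hr
          have h6 := ha3 i v u hr.symm
          rcases lt_or_gt_of_ne hne with hlt | hlt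
          · have := h5 hlt
            have hI' := hI.resolve_right fun h => by linarith
            exact Or.inl ⟨le_of_not_gt fun h => by linarith [h2 h],
              le_of_not_gt fun h => by linarith [h3 h]⟩
          · have := h6 hlt
            have hI' := hI.resolve_left fun h => by linarith
            exact Or.inr ⟨le_of_not_gt fun h => by linarith [h4 h],
              le_of_not_gt fun h => by linarith [h1 h]⟩)
        have := hn j hj
        rw [hshift' w hwr z j hj] at this
        linarith
  simp only [sees_cube_iff _ hdisj, key, hH, exists_and_left, exists_eq', and_true]

/-- The given forests may share edges. Each edge is assigned to one forest containing it, and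
`Represents.anti` lets the others drop it. -/
theorem isVisibilityGraph_of_forests {V : Type*} [Finite V] {T : SimpleGraph V}
    (hT : T.IsTree) {m : ℕ} (F : Fin (m + 1) → T.Subgraph)
    (hF : ∀ i, IsOrthVisibilityForest m (F i).coe) (hcover : ⨆ i, F i = ⊤) :
    IsVisibilityGraph (m + 1) T := by
  have hcov : ∀ e : Sym2 V, ∃ i, e ∈ T.edgeSet → e ∈ (F i).spanningCoe.edgeSet := by
    intro e
    by_cases he : e ∈ T.edgeSet
    · induction e with
      | _ u v =>
        have h : (⨆ i, F i).Adj u v := by rw [hcover]; exact he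
        obtain ⟨i, hi⟩ := SimpleGraph.Subgraph.iSup_adj.1 h
        exact ⟨i, fun _ => hi⟩
    -- The colour of a non-edge plays no role.
    · exact ⟨0, fun h => absurd h he⟩
  choose f hf using hcov
  have hrep : ∀ i, ∃ p : V → Fin (m + 1) → ℝ, Represents (F i).spanningCoe i p := by
    intro i
    obtain ⟨p, hp⟩ := (isOrthVisibilityForest_iff m (hT.isAcyclic.subgraph _)).1 (hF i)
    obtain ⟨p', hp'⟩ : ∃ p' : V → Fin (m + 1) → ℝ, p = fun v : (F i).verts => p' v := by
      classical
      -- The value 0 outside the subgraph is immaterial: such vertices are isolated in the spanning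
      -- version.
      exact ⟨fun v => if hv : v ∈ (F i).verts then p ⟨v, hv⟩ else 0, by ext v; simp⟩
    rw [hp', represents_coe_iff] at hp
    exact ⟨_, hp.comp_equiv (Equiv.swap i (Fin.last m)) (Equiv.swap_apply_left _ _)⟩
  choose p hp using hrep
  let H : Fin (m + 1) → SimpleGraph V := fun i =>
    { Adj := fun u v => T.Adj u v ∧ f s(u, v) = i
      symm := ⟨fun u v h => ⟨h.1.symm, by rw [Sym2.eq_swap]; exact h.2⟩⟩
      loopless := ⟨fun u h => h.1.ne rfl⟩ }
  have hle : ∀ i, H i ≤ (F i).spanningCoe := by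
    rintro i u v ⟨h, rfl⟩
    exact hf s(u, v) h
  exact isVisibilityGraph_of_represents hT 0 f H (fun i u v => Iff.rfl) p fun i =>
    (hp i).anti (hT.isAcyclic.anti (F i).spanningCoe_le) (hle i)

end CubeVisibility

theorem mainTheorem1 {V : Type*} [Finite V] (T : SimpleGraph V) (hT : T.IsTree)
    (n : ℕ) (hn : 1 ≤ n) :
    CubeVisibility.IsVisibilityGraph n T ↔
      ∃ F : Fin n → T.Subgraph,
        (∀ i, CubeVisibility.IsOrthVisibilityForest (n - 1) (F i).coe) ∧ ⨆ i, F i = ⊤ := by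
  obtain ⟨m, rfl⟩ : ∃ m, n = m + 1 := ⟨n - 1, by omega⟩
  exact ⟨CubeVisibility.exists_forests_of_isVisibilityGraph hT.isAcyclic,
    fun ⟨F, hF, hcover⟩ => CubeVisibility.isVisibilityGraph_of_forests hT F hF hcover⟩
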